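/- Let $n=p^m$, where $p$ is an odd prime and $m\ge 1$, and let $T_{4n}=\langle a,b\mid a^{2n}=1,\ a^n=b^2,\ b^{-1}ab=a^{-1}\rangle$ be the dicyclic group of order $4n$. Let $1\le k_1<\dots<k_r\le n-1$ be integers, put $S=\{a^{\pm k_1},\dots,a^{\pm k_r}\}\cup\langle a\rangle b$, and let $r_{\mathrm{odd}}$ be the number of odd integers among $k_1,\dots,k_r$. Let $\Gamma=\mathrm{Cay}(T_{4n},S)$ be the graph with vertex set $T_{4n}$ and edges $\{g,sg\}$ $(g\in T_{4n},\ s\in S)$, let $A$ be its adjacency matrix, and let $H(t)=\exp(\mathrm{i}tA)$ for $t\in\mathbb{R}$. For distinct vertices $x,y$, say that $\Gamma$ admits pretty good fractional revival (PGFR) from $x$ to $y$ if there are a sequence $(t_j)$ of real numbers and complex numbers $\alpha,\beta$ with $|\alpha|^2+|\beta|^2=1$ and $\beta\neq 0$ such that $\lim_{j\to\infty}H(t_j)\mathbf{e}_x=\alpha\mathbf{e}_x+\beta\mathbf{e}_y$. If $\gcd(r_{\mathrm{odd}},p)=1$, then $\Gamma$ admits PGFR. More precisely, for every integer $u$, $\Gamma$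 admits PGFR from $a^u$ to $a^{u+n}$ and from $a^ub$ to $a^{u+n}b$ (hence, as $a^{2n}=1$, in both directions between these vertices). -/

import Mathlib

/-!
Let `ζ = exp (π i / n)`. The graph has an explicit eigenbasis built from the characters of `⟨a⟩`,
with eigenvalues in `ℤ[ζ]`, and translation by `a ^ n` acts on it by signs `±1`. As `ζ` has order
`2 * p ^ m`, there is a ring homomorphism `ℤ[ζ] → 𝔽_p` with `ζ ↦ -1`; it sends an eigenvalue with
sign `s` to `2 * ∑ k ∈ K, s ^ k`. Hence every integer relation between the eigenvalues persists
between these residues, and by Kronecker's theorem there are times at which the phase of each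
eigenvector with sign `s` approaches `2 * (∑ k ∈ K, s ^ k) / p` modulo `1`. The phases for `s = 1`
and `s = -1` differ by `4 * r_odd / p`, which is not an integer, so in the limit the state at a
vertex `x` becomes a superposition of `x` and `a ^ n * x` that is not concentrated at `x`.
-/

namespace PGFR

open Filter
open scoped Topology Matrix

/-- The Cayley graph `Cay(G, S)`, with vertex set `G` and edges `{g, s g}` for `g ∈ G`, `s ∈ S`. -/
def cayleyGraph {G : Type*} [Group G] (S : Set G) : SimpleGraph G :=
  SimpleGraph.fromRel fun g h => ∃ s ∈ S, h = s * g

noncomputable instance {G : Type*} [Group G] (S : Set G) : DecidableRel (cayleyGraph S).Adj :=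
  Classical.decRel _

/-- The transition matrix `H(t) = exp(i t A)`, where `A` is the adjacency matrix of `Γ`. -/
noncomputable def transitionMatrix {V : Type*} [Fintype V] [DecidableEq V]
    (Γ : SimpleGraph V) [DecidableRel Γ.Adj] (t : ℝ) : Matrix V V ℂ :=
  NormedSpace.exp ((Complex.I * (t : ℂ)) • Γ.adjMatrix ℂ)

/-- Pretty good fractional revival from `u` to `v`: the vertices are distinct and
`H(t_j) e_u → α e_u + β e_v` along some sequence of real times, with `|α|² + |β|² = 1`.
The case `β = 0` (approximate periodicity, which holds trivially) is excluded. -/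
def AdmitsPGFR {V : Type*} [Fintype V] [DecidableEq V]
    (Γ : SimpleGraph V) [DecidableRel Γ.Adj] (u v : V) : Prop :=
  u ≠ v ∧ ∃ (t : ℕ → ℝ) (α β : ℂ), ‖α‖ ^ 2 + ‖β‖ ^ 2 = 1 ∧ β ≠ 0 ∧
    Tendsto (fun j => transitionMatrix Γ (t j) *ᵥ Pi.single u (1 : ℂ)) atTop
      (𝓝 (α • Pi.single u (1 : ℂ) + β • Pi.single v (1 : ℂ)))

/-- The generator `a` of the dicyclic group
`T_{4n} = ⟨a, b ∣ a^{2n} = 1, a^n = b^2, b⁻¹ a b = a⁻¹⟩`. -/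
def genA (n : ℕ) : QuaternionGroup n := QuaternionGroup.a 1

/-- The generator `b` of the dicyclic group. -/
def genB (n : ℕ) : QuaternionGroup n := QuaternionGroup.xa 0

/-- The connection set `{a^{±k} ∣ k ∈ K} ∪ ⟨a⟩ b`. -/
def connectionSet (n : ℕ) (K : Finset ℕ) : Set (QuaternionGroup n) :=
  {g | ∃ k ∈ K, g = genA n ^ k ∨ g = (genA n ^ k)⁻¹} ∪
    {g | ∃ c ∈ Subgroup.zpowers (genA n), g = c * genB n}

end PGFR

namespace PGFR

open Filter MeasureTheory
open scoped Topology Matrix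

section Kronecker

lemma integral_addChar_eq_zero {G : Type*} [AddGroup G] [MeasurableSpace G] [MeasurableAdd G]
    {μ : Measure G} [μ.IsAddRightInvariant] {χ : AddChar G ℂ} (hχ : χ ≠ 1) :
    ∫ g, χ g ∂μ = 0 := by
  obtain ⟨y, hy⟩ := AddChar.ne_one_iff.mp hχ
  have htranslate : (∫ g, χ g ∂μ) * χ y = ∫ g, χ g ∂μ := by
    rw [← integral_mul_const, ← integral_add_right_eq_self (μ := μ) χ y]
    simp only [AddChar.map_add_eq_mul]
  by_contra hne
  exact hy (mul_eq_left₀ hne |>.mp htranslate)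

variable {ι : Type*} [Fintype ι]

/-- The exponential monomial `UnitAddTorus.mFourier c`, as an additive character of the torus. -/
noncomputable def torusChar (c : ι → ℤ) : AddChar (UnitAddTorus ι) ℂ where
  toFun := UnitAddTorus.mFourier c
  map_zero_eq_one' := by simp [UnitAddTorus.mFourier]
  map_add_eq_mul' x y := by
    simp [UnitAddTorus.mFourier, fourier_apply, Finset.prod_mul_distrib, AddCircle.toCircle_add]

lemma torusChar_eq_one_iff (c : ι → ℤ) (x : UnitAddTorus ι) :
    torusChar c x = 1 ↔ ∑ i, c i • x i = 0 := by
  have hsum : torusChar c x = (AddCircle.toCircle (∑ i, c i • x i) : ℂ) :=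
    calc torusChar c x = ∏ i, Circle.coeHom (AddCircle.toCircle_addChar (c i • x i)) := rfl
      _ = Circle.coeHom (AddCircle.toCircle_addChar (∑ i, c i • x i)) := by
        rw [← map_prod]
        exact congrArg Circle.coeHom
          (map_sum AddCircle.toCircle_addChar.toAddMonoidHom (fun i => c i • x i) _).symm
  rw [hsum, Circle.coe_eq_one, ← AddCircle.toCircle_zero (T := 1),
    (AddCircle.injective_toCircle one_ne_zero).eq_iff]

lemma measure_ext_of_integral_torusChar_eq {μ ν : Measure (UnitAddTorus ι)} [IsFiniteMeasure μ]
    [IsFiniteMeasure ν] (h : ∀ c : ι → ℤ, ∫ x, torusChar c x ∂μ = ∫ x, torusChar c x ∂ν) :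
    μ = ν := by
  have integrable (f : C(UnitAddTorus ι, ℂ)) (ρ : Measure (UnitAddTorus ι)) [IsFiniteMeasure ρ] :
      Integrable f ρ :=
    f.continuous.integrable_of_hasCompactSupport (.of_compactSpace _)
  refine ext_of_forall_mem_subalgebra_integral_eq_of_polish (𝕜 := ℂ)
    (A := (UnitAddTorus.mFourierSubalgebra ι).comap
      (BoundedContinuousFunction.toContinuousMapStarₐ ℂ)) ?_ fun g hg => ?_
  · intro x y hxy
    obtain ⟨_, ⟨f, hf, rfl⟩, hne⟩ := UnitAddTorus.mFourierSubalgebra_separatesPoints hxy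
    exact ⟨f, ⟨f, ⟨.mkOfCompact f, hf, rfl⟩, rfl⟩, hne⟩
  · have hspan : (g : C(UnitAddTorus ι, ℂ)) ∈
        Submodule.span ℂ (Set.range UnitAddTorus.mFourier) := by
      rw [← UnitAddTorus.mFourierSubalgebra_coe]
      exact hg
    change ∫ x, (g : C(UnitAddTorus ι, ℂ)) x ∂μ = ∫ x, (g : C(UnitAddTorus ι, ℂ)) x ∂ν
    generalize (g : C(UnitAddTorus ι, ℂ)) = f at hspan ⊢
    induction hspan using Submodule.span_induction with
    | mem f hf => obtain ⟨c, rfl⟩ := hf; exact h c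
    | zero => simp
    | add f₁ f₂ _ _ h₁ h₂ =>
      simp only [ContinuousMap.add_apply]
      rw [integral_add (integrable f₁ μ) (integrable f₂ μ),
        integral_add (integrable f₁ ν) (integrable f₂ ν), h₁, h₂]
    | smul a f _ hf => simp only [ContinuousMap.smul_apply, integral_smul, hf]

/-- Translation by `x` fixes the Fourier coefficients of the Haar measure of `H`, hence that
measure, so that `H + x` meets `H`. -/
theorem mem_of_forall_sum_zsmul_eq_zero {H : AddSubgroup (UnitAddTorus ι)}
    (hH : IsClosed (H : Set (UnitAddTorus ι))) {x : UnitAddTorus ι}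
    (hx : ∀ c : ι → ℤ, (∀ y ∈ H, ∑ i, c i • y i = 0) → ∑ i, c i • x i = 0) : x ∈ H := by
  have : CompactSpace H := isCompact_iff_compactSpace.mp hH.isCompact
  let ν : Measure (UnitAddTorus ι) := (Measure.addHaar : Measure H).map Subtype.val
  have htranslate : ν.map (· + x) = ν := by
    refine measure_ext_of_integral_torusChar_eq fun c => ?_
    have hmeas (ρ : Measure (UnitAddTorus ι)) : AEStronglyMeasurable (torusChar c) ρ :=
      (UnitAddTorus.mFourier c).continuous.aestronglyMeasurable
    rw [integral_map (by fun_prop) (hmeas _)]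
    simp only [AddChar.map_add_eq_mul]
    rw [integral_mul_const]
    by_cases htriv : (torusChar c).compAddMonoidHom H.subtype = 1
    · have hcx : torusChar c x = 1 := by
        simp only [torusChar_eq_one_iff]
        refine hx c fun y hy => ?_
        rw [← torusChar_eq_one_iff]
        exact DFunLike.congr_fun htriv ⟨y, hy⟩
      rw [hcx, mul_one]
    · have hzero : ∫ y, torusChar c y ∂ν = 0 := by
        rw [integral_map measurable_subtype_coe.aemeasurable (hmeas _)]
        exact integral_addChar_eq_zero htriv
      rw [hzero, zero_mul]
  have hmem : ∀ᵐ y ∂ν, y ∈ H :=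
    (ae_map_iff measurable_subtype_coe.aemeasurable hH.measurableSet).mpr (.of_forall Subtype.prop)
  have hmem_add : ∀ᵐ y ∂ν, y + x ∈ H := by
    rw [← htranslate] at hmem
    exact (ae_map_iff (by fun_prop) hH.measurableSet).mp hmem
  have : (ae ν).NeBot :=
    ae_neBot.mpr ((Measure.map_ne_zero_iff measurable_subtype_coe.aemeasurable).mpr (NeZero.ne _))
  obtain ⟨y, hy, hyx⟩ := (hmem.and hmem_add).exists
  exact (H.add_mem_cancel_left hy).mp hyx

theorem kronecker_exists_seq_tendsto (μ : ι → ℝ) (θ : ι → UnitAddCircle)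
    (h : ∀ c : ι → ℤ, ∑ i, (c i : ℝ) * μ i = 0 → ∑ i, c i • θ i = 0) :
    ∃ t : ℕ → ℝ, ∀ i, Tendsto (fun j => ((t j * μ i : ℝ) : UnitAddCircle)) atTop (𝓝 (θ i)) := by
  let line : ℝ →+ UnitAddTorus ι := AddMonoidHom.mk' (fun t i => ((t * μ i : ℝ) : UnitAddCircle))
    fun s t => by ext i; simp [add_mul]
  have hmem : θ ∈ line.range.topologicalClosure := by
    refine mem_of_forall_sum_zsmul_eq_zero (AddSubgroup.isClosed_topologicalClosure _)
      fun c hc => h c ?_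
    set s := ∑ i, (c i : ℝ) * μ i
    by_contra hne
    -- At time `1 / (2 * s)` the relation takes the value `1 / 2`, which is not an integer.
    have hrel : ((∑ i, c i * (1 / 2 / s * μ i) : ℝ) : UnitAddCircle) = 0 := by
      rw [← hc (line (1 / 2 / s)) (AddSubgroup.le_topologicalClosure _ ⟨_, rfl⟩)]
      simp [line, ← zsmul_eq_mul]
    have hhalf : ∑ i, c i * (1 / 2 / s * μ i) = 1 / 2 := by
      simp only [mul_left_comm (c _ : ℝ)]
      rw [← Finset.mul_sum]
      exact div_mul_cancel₀ _ hne
    rw [hhalf, AddCircle.coe_eq_zero_iff] at hrel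
    obtain ⟨k, hk⟩ := hrel
    have hk2 : k * 2 = 1 := by
      rw [zsmul_eq_mul, mul_one, eq_div_iff two_ne_zero] at hk
      exact_mod_cast hk
    omega
  obtain ⟨y, hy, hlim⟩ := mem_closure_iff_seq_limit.mp hmem
  choose t ht using hy
  refine ⟨t, fun i => ?_⟩
  exact (tendsto_pi_nhds.mp hlim i).congr fun j => (congrFun (ht j) i).symm

end Kronecker

section Revival

variable {V W : Type*} [Fintype V] [DecidableEq V] [Fintype W] [DecidableEq W]

lemma exp_smul_mulVec_of_mulVec_eq_smul {A : Matrix V V ℂ} {μ : ℂ} {v : V → ℂ}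
    (hv : A *ᵥ v = μ • v) (z : ℂ) : NormedSpace.exp (z • A) *ᵥ v = Complex.exp (z * μ) • v := by
  let _ : NormedRing (Matrix V V ℂ) := Matrix.linftyOpNormedRing
  let _ : NormedAlgebra ℂ (Matrix V V ℂ) := Matrix.linftyOpNormedAlgebra
  have hpow (k : ℕ) : (z • A) ^ k *ᵥ v = (z * μ) ^ k • v := by
    induction k with
    | zero => simp
    | succ k ih =>
      rw [pow_succ, ← Matrix.mulVec_mulVec, Matrix.smul_mulVec, hv, smul_smul,
        Matrix.mulVec_smul, ih, smul_smul, pow_succ']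
  have hmulVec : Continuous fun M : Matrix V V ℂ => M *ᵥ v := by fun_prop
  have hleft := (NormedSpace.exp_series_hasSum_exp' (𝕂 := ℂ) (z • A)).map
    (Matrix.mulVec.addMonoidHomLeft v) hmulVec
  have hright := (NormedSpace.exp_series_hasSum_exp' (𝕂 := ℂ) (z * μ)).smul_const v
  rw [Complex.exp_eq_exp_ℂ]
  refine hleft.unique (hright.congr_fun fun k => ?_)
  change ((k.factorial : ℂ)⁻¹ • (z • A) ^ k) *ᵥ v = _
  rw [Matrix.smul_mulVec, hpow, smul_assoc]

lemma transitionMatrix_two_pi_mul_mulVec {Γ : SimpleGraph V} [DecidableRel Γ.Adj] {μ : ℝ}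
    {v : V → ℂ} (hv : Γ.adjMatrix ℂ *ᵥ v = (μ : ℂ) • v) (t : ℝ) :
    transitionMatrix Γ (2 * Real.pi * t) *ᵥ v =
      (AddCircle.toCircle ((t * μ : ℝ) : UnitAddCircle) : ℂ) • v := by
  rw [transitionMatrix, exp_smul_mulVec_of_mulVec_eq_smul hv, AddCircle.toCircle_apply_mk,
    Circle.coe_exp]
  congr 2
  push_cast
  ring

lemma transitionMatrix_submatrix_iso {Γ : SimpleGraph V} {Γ' : SimpleGraph W}
    [DecidableRel Γ.Adj] [DecidableRel Γ'.Adj] (φ : Γ ≃g Γ') (t : ℝ) :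
    (transitionMatrix Γ' t).submatrix φ φ = transitionMatrix Γ t := by
  let e : Matrix W W ℂ ≃ₐ[ℂ] Matrix V V ℂ := Matrix.reindexAlgEquiv ℂ ℂ φ.toEquiv.symm
  have hadj : e (Γ'.adjMatrix ℂ) = Γ.adjMatrix ℂ := by
    ext x y
    simp [e, SimpleGraph.adjMatrix_apply, φ.map_adj_iff]
  change e.toLinearEquiv.toContinuousLinearEquiv (transitionMatrix Γ' t) = _
  simp [transitionMatrix, NormedSpace.exp_eq_tsum ℂ, ContinuousLinearEquiv.map_tsum, ← hadj]

theorem AdmitsPGFR.map_iso {Γ : SimpleGraph V} {Γ' : SimpleGraph W} [DecidableRel Γ.Adj]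
    [DecidableRel Γ'.Adj] {x y : V} (h : AdmitsPGFR Γ x y) (φ : Γ ≃g Γ') :
    AdmitsPGFR Γ' (φ x) (φ y) := by
  obtain ⟨hxy, t, α, β, hαβ, hβ, hlim⟩ := h
  refine ⟨φ.injective.ne hxy, t, α, β, hαβ, hβ, ?_⟩
  rw [tendsto_pi_nhds] at hlim ⊢
  intro w
  obtain ⟨v, rfl⟩ := φ.surjective w
  convert hlim v using 2
  · rw [← transitionMatrix_submatrix_iso φ]
    simp
  · simp [Pi.single_apply]

/-- Since `σ i = ±1`, steering the phase of `v i` to `γ (σ i)` turns the state `∑ i, v i` into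
the superposition of `∑ i, v i` and `∑ i, σ i • v i` with amplitudes `(γ 1 ± γ (-1)) / 2`. -/
theorem admitsPGFR_of_eigenvectors {Γ : SimpleGraph V} [DecidableRel Γ.Adj] {x y : V} (hxy : x ≠ y)
    {ι : Type*} [Fintype ι] {μ : ι → ℝ} {v : ι → V → ℂ} {σ : ι → ℤˣ}
    (hv : ∀ i, Γ.adjMatrix ℂ *ᵥ v i = (μ i : ℂ) • v i)
    (hx : ∑ i, v i = Pi.single x 1) (hy : ∑ i, ((σ i : ℤ) : ℂ) • v i = Pi.single y 1)
    {θ : ℤˣ → UnitAddCircle} (hθ : θ 1 ≠ θ (-1))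
    (hrel : ∀ c : ι → ℤ, ∑ i, (c i : ℝ) * μ i = 0 → ∑ i, c i • θ (σ i) = 0) :
    AdmitsPGFR Γ x y := by
  obtain ⟨t, ht⟩ := kronecker_exists_seq_tendsto μ (fun i => θ (σ i)) hrel
  let γ (s : ℤˣ) : ℂ := AddCircle.toCircle (θ s)
  have hγ_norm (s : ℤˣ) : ‖γ s‖ = 1 := Circle.norm_coe _
  have hγ_ne : γ 1 ≠ γ (-1) := fun h =>
    hθ (AddCircle.injective_toCircle one_ne_zero (Circle.coe_injective h))
  have hγ (s : ℤˣ) : γ s = (γ 1 + γ (-1)) / 2 + (γ 1 - γ (-1)) / 2 * ((s : ℤ) : ℂ) := by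
    obtain rfl | rfl := Int.units_eq_one_or s <;> push_cast <;> ring
  refine ⟨hxy, fun j => 2 * Real.pi * t j, (γ 1 + γ (-1)) / 2, (γ 1 - γ (-1)) / 2, ?_, ?_, ?_⟩
  · have hpar := parallelogram_law_with_norm ℝ (γ 1) (γ (-1))
    rw [hγ_norm, hγ_norm] at hpar
    rw [norm_div, norm_div, Complex.norm_ofNat]
    linear_combination hpar / 4
  · exact div_ne_zero (sub_ne_zero.mpr hγ_ne) two_ne_zero
  · have hstate : ((γ 1 + γ (-1)) / 2) • Pi.single x (1 : ℂ) +
        ((γ 1 - γ (-1)) / 2) • Pi.single y (1 : ℂ) = ∑ i, γ (σ i) • v i := by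
      rw [← hx, ← hy, Finset.smul_sum, Finset.smul_sum, ← Finset.sum_add_distrib]
      exact Finset.sum_congr rfl fun i _ => by rw [smul_smul, ← add_smul, ← hγ]
    have htoCircle : Continuous fun z : UnitAddCircle => (AddCircle.toCircle z : ℂ) :=
      continuous_subtype_val.comp AddCircle.continuous_toCircle
    rw [hstate]
    simp only [← hx, Matrix.mulVec_sum, transitionMatrix_two_pi_mul_mulVec (hv _)]
    refine tendsto_finsetSum _ fun i _ => Tendsto.smul_const ?_ (v i)
    exact (htoCircle.tendsto _).comp (ht i)

end Revival

section CayleyGraph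

variable {G : Type*} [Group G] {S : Set G}

lemma cayleyGraph_adj {g h : G} :
    (cayleyGraph S).Adj g h ↔ g ≠ h ∧ (h * g⁻¹ ∈ S ∨ g * h⁻¹ ∈ S) := by
  simp [cayleyGraph, ← mul_inv_eq_iff_eq_mul]

lemma cayleyGraph_adj_iff_mul_inv_mem (hinv : ∀ s ∈ S, s⁻¹ ∈ S) (hone : 1 ∉ S) {g h : G} :
    (cayleyGraph S).Adj g h ↔ h * g⁻¹ ∈ S := by
  rw [cayleyGraph_adj]
  constructor
  · rintro ⟨-, hmem | hmem⟩
    · exact hmem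
    · simpa using hinv _ hmem
  · exact fun hmem => ⟨by rintro rfl; exact hone (by simpa using hmem), .inl hmem⟩

variable (S) in
/-- Right multiplication by `g`, as an automorphism of `Cay(G, S)`. -/
def cayleyGraphMulRight (g : G) : cayleyGraph S ≃g cayleyGraph S where
  toEquiv := Equiv.mulRight g
  map_rel_iff' := by simp [cayleyGraph_adj]

variable [Fintype G]

theorem AdmitsPGFR.mul_right [DecidableEq G] {x y : G} (h : AdmitsPGFR (cayleyGraph S) x y)
    (g : G) : AdmitsPGFR (cayleyGraph S) (x * g) (y * g) :=
  h.map_iso (cayleyGraphMulRight S g)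

lemma adjMatrix_cayleyGraph_mulVec_apply [DecidablePred (· ∈ S)] (hinv : ∀ s ∈ S, s⁻¹ ∈ S)
    (hone : 1 ∉ S) (F : G → ℂ) (g : G) :
    ((cayleyGraph S).adjMatrix ℂ *ᵥ F) g = ∑ s with s ∈ S, F (s * g) := by
  rw [SimpleGraph.adjMatrix_mulVec_apply]
  refine (Finset.sum_equiv (Equiv.mulRight g) (fun s => ?_) fun _ _ => rfl).symm
  simp [cayleyGraph_adj_iff_mul_inv_mem hinv hone]

end CayleyGraph

section Dicyclic

open QuaternionGroup

variable {n : ℕ}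

lemma genA_pow (k : ℕ) : genA n ^ k = a (k : ZMod (2 * n)) :=
  a_one_pow k

lemma inv_a (i : ZMod (2 * n)) : (a i)⁻¹ = a (-i) := rfl

lemma genA_zpow (u : ℤ) : genA n ^ u = a (u : ZMod (2 * n)) := by
  obtain ⟨k, rfl | rfl⟩ := u.eq_nat_or_neg
  · rw [zpow_natCast, genA_pow, Int.cast_natCast]
  · rw [zpow_neg, zpow_natCast, genA_pow, inv_a, Int.cast_neg, Int.cast_natCast]

lemma a_mem_connectionSet {K : Finset ℕ} {i : ZMod (2 * n)} :
    a i ∈ connectionSet n K ↔ ∃ k ∈ K, i = k ∨ i = -k := by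
  simp [connectionSet, Subgroup.mem_zpowers_iff, genA_pow, genA_zpow, genB, inv_a]

lemma xa_mem_connectionSet (K : Finset ℕ) (i : ZMod (2 * n)) : xa i ∈ connectionSet n K := by
  obtain ⟨z, hz⟩ := ZMod.intCast_surjective (-i)
  exact .inr ⟨genA n ^ z, ⟨z, rfl⟩, by rw [genA_zpow, genB, a_mul_xa, hz, zero_sub, neg_neg]⟩

lemma inv_mem_connectionSet {K : Finset ℕ} {g : QuaternionGroup n} (hg : g ∈ connectionSet n K) :
    g⁻¹ ∈ connectionSet n K := by
  obtain i | i := g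
  · rw [inv_a, a_mem_connectionSet]
    obtain ⟨k, hk, h⟩ := a_mem_connectionSet.mp hg
    exact ⟨k, hk, by rwa [neg_inj, neg_eq_iff_eq_neg, or_comm]⟩
  · exact xa_mem_connectionSet K _

section Neighbors

variable {K : Finset ℕ} (hK : ∀ k ∈ K, 1 ≤ k ∧ k ≤ n - 1)
include hK

lemma natCast_injOn : Set.InjOn (fun k : ℕ => (k : ZMod (2 * n))) K := by
  intro k hk l hl h
  have hk' := hK k hk
  have hl' := hK l hl
  exact ((ZMod.natCast_eq_natCast_iff _ _ _).mp h).eq_of_lt_of_lt (by omega) (by omega)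

lemma natCast_ne_neg_natCast {k l : ℕ} (hk : k ∈ K) (hl : l ∈ K) :
    (k : ZMod (2 * n)) ≠ -l := by
  have hk' := hK k hk
  have hl' := hK l hl
  rw [Ne, ← add_eq_zero_iff_eq_neg, ← Nat.cast_add, ZMod.natCast_eq_zero_iff]
  exact Nat.not_dvd_of_pos_of_lt (by omega) (by omega)

lemma one_notMem_connectionSet : 1 ∉ connectionSet n K := by
  rw [one_def, a_mem_connectionSet]
  rintro ⟨k, hk, h⟩
  exact natCast_ne_neg_natCast hK hk hk (by grind)

lemma sum_filter_natCast_or_neg [NeZero n] {M : Type*} [AddCommMonoid M]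
    [DecidablePred fun i : ZMod (2 * n) => ∃ k ∈ K, i = k ∨ i = -k] (F : ZMod (2 * n) → M) :
    ∑ i with ∃ k ∈ K, i = (k : ZMod (2 * n)) ∨ i = -k, F i = ∑ k ∈ K, (F k + F (-k)) := by
  have hset : (Finset.univ.filter fun i => ∃ k ∈ K, i = (k : ZMod (2 * n)) ∨ i = -k) =
      K.image (fun k : ℕ => (k : ZMod (2 * n))) ∪ K.image (fun k : ℕ => -(k : ZMod (2 * n))) := by
    grind
  rw [hset, Finset.sum_union, Finset.sum_image (natCast_injOn hK), Finset.sum_image,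
    Finset.sum_add_distrib]
  · exact fun k hk l hl h => natCast_injOn hK hk hl (neg_injective h)
  · rw [Finset.disjoint_left]
    intro i hi hi'
    obtain ⟨k, hk, rfl⟩ := Finset.mem_image.mp hi
    obtain ⟨l, hl, h⟩ := Finset.mem_image.mp hi'
    exact natCast_ne_neg_natCast hK hk hl h.symm

end Neighbors

lemma sum_quaternionGroup [NeZero n] {M : Type*} [AddCommMonoid M] (F : QuaternionGroup n → M) :
    ∑ g, F g = ∑ i, F (a i) + ∑ i, F (xa i) := by
  let e : ZMod (2 * n) ⊕ ZMod (2 * n) ≃ QuaternionGroup n :=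
    { toFun := Sum.elim a xa
      invFun
        | a i => .inl i
        | xa i => .inr i
      left_inv := by rintro (i | i) <;> rfl
      right_inv := by rintro (i | i) <;> rfl }
  rw [← e.sum_comp, Fintype.sum_sum_type]
  rfl

theorem adjMatrix_connectionSet_mulVec_apply [NeZero n] {K : Finset ℕ}
    (hK : ∀ k ∈ K, 1 ≤ k ∧ k ≤ n - 1) (F : QuaternionGroup n → ℂ) (g : QuaternionGroup n) :
    ((cayleyGraph (connectionSet n K)).adjMatrix ℂ *ᵥ F) g =
      ∑ k ∈ K, (F (a k * g) + F (a (-k) * g)) + ∑ j, F (xa j * g) := by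
  classical
  rw [adjMatrix_cayleyGraph_mulVec_apply (fun _ => inv_mem_connectionSet)
    (one_notMem_connectionSet hK), Finset.sum_filter, sum_quaternionGroup]
  simp only [a_mem_connectionSet, xa_mem_connectionSet, if_true]
  rw [← Finset.sum_filter, sum_filter_natCast_or_neg hK fun i => F (a i * g)]

end Dicyclic

section Reduction

open Polynomial

/-- So `ζ ↦ ξ` is the reduction of `ℤ[ζ]` at a prime above `p`. The reason is that modulo `p` the
cyclotomic polynomial of order `p ^ k * m` is a power of the one of order `m`. -/
theorem aeval_eq_zero_of_isPrimitiveRoot_prime_pow_mul {p k m : ℕ} [Fact p.Prime] {R : Type*}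
    [CommRing R] [IsDomain R] [CharP R p] [NeZero (m : R)] {ξ : R} (hξ : IsPrimitiveRoot ξ m)
    {F : Type*} [Field F] [CharZero F] {ζ : F} (hζ : IsPrimitiveRoot ζ (p ^ k * m))
    {P : ℤ[X]} (hP : aeval ζ P = 0) : aeval ξ P = 0 := by
  have hm : 0 < m := Nat.pos_of_ne_zero (NeZero.of_neZero_natCast R (n := m)).out
  have hpos : 0 < p ^ k * m := Nat.mul_pos (pow_pos (Fact.out : p.Prime).pos k) hm
  have hdvd : cyclotomic (p ^ k * m) ℤ ∣ P := by
    rw [cyclotomic_eq_minpoly hζ hpos]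
    exact minpoly.isIntegrallyClosed_dvd (hζ.isIntegral hpos) hP
  obtain ⟨Q, rfl⟩ := hdvd
  have hroot : (cyclotomic (p ^ k * m) R).IsRoot ξ :=
    (isRoot_cyclotomic_prime_pow_mul_iff_of_charP (k := k)).mpr hξ
  rw [map_mul, ← eval_map_algebraMap, map_cyclotomic, hroot.eq_zero, zero_mul]

end Reduction

section Spectrum

open Polynomial QuaternionGroup

variable {n : ℕ}

lemma sum_neg_one_pow (K : Finset ℕ) {R : Type*} [Ring R] :
    ∑ k ∈ K, (-1 : R) ^ k = K.card - 2 * (K.filter fun k => Odd k).card := by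
  have hparity (k : ℕ) : (-1 : R) ^ k = 1 - 2 * if Odd k then 1 else 0 := by
    obtain hk | hk := Nat.even_or_odd k
    · simp [hk.neg_one_pow, Nat.not_odd_iff_even.mpr hk]
    · rw [hk.neg_one_pow, if_pos hk]
      norm_num
  simp only [hparity, Finset.sum_sub_distrib, ← Finset.mul_sum]
  simp

/-- The phase, a multiple of `1 / p`, to which the eigenvectors with `a ^ n = s` are steered: the
reduction modulo `p` of their eigenvalues. -/
noncomputable def phase (p : ℕ) [NeZero p] (K : Finset ℕ) (s : ℤˣ) : UnitAddCircle :=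
  ZMod.toAddCircle (2 * ∑ k ∈ K, ((s : ℤ) : ZMod p) ^ k)

lemma phase_one_ne_phase_neg_one {p : ℕ} [Fact p.Prime] (hodd : Odd p) {K : Finset ℕ}
    (hK : (K.filter fun k => Odd k).card.Coprime p) : phase p K 1 ≠ phase p K (-1) := by
  intro h
  have hcard : ((4 * (K.filter fun k => Odd k).card : ℕ) : ZMod p) = 0 := by
    have heq := ZMod.toAddCircle_inj.mp h
    simp only [Units.val_one, Units.val_neg, Int.cast_one, Int.cast_neg, one_pow,
      sum_neg_one_pow, Finset.sum_const, nsmul_one] at heq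
    push_cast
    linear_combination heq
  have hdvd := hK.symm.dvd_of_dvd_mul_right ((ZMod.natCast_eq_zero_iff _ _).mp hcard)
  have hcop : p.Coprime (2 ^ 2) := (Nat.coprime_two_right.mpr hodd).pow_right 2
  exact (Fact.out : p.Prime).one_lt.ne' (hcop.eq_one_of_dvd hdvd)

/-- An integer polynomial whose value at `exp (π i / n)` is `eigenvalue K i`. The exponent
`2 * n - 1` stands for `-1`. -/
noncomputable def eigenvaluePoly (K : Finset ℕ) (i : ZMod (2 * n) × ℤˣ) : ℤ[X] :=
  ∑ k ∈ K, (X ^ (i.1.val * k) + X ^ ((2 * n - 1) * (i.1.val * k))) +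
    if i.1 = 0 then C (2 * n * (i.2 : ℤ)) else 0

variable [NeZero n]

lemma natCast_half_ne_zero : (n : ZMod (2 * n)) ≠ 0 := by
  rw [Ne, ZMod.natCast_eq_zero_iff]
  exact Nat.not_dvd_of_pos_of_lt (NeZero.pos n) (by have := NeZero.pos n; omega)

lemma isPrimitiveRoot_stdAddChar_one {N : ℕ} [NeZero N] :
    IsPrimitiveRoot (ZMod.stdAddChar (1 : ZMod N)) N := by
  convert Complex.isPrimitiveRoot_exp N (NeZero.ne _) using 1
  simpa using ZMod.stdAddChar_coe (N := N) 1

lemma sum_stdAddChar_mul {N : ℕ} [NeZero N] (l : ZMod N) :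
    ∑ j, ZMod.stdAddChar (j * l) = if l = 0 then (N : ℂ) else 0 := by
  rw [AddChar.sum_mulShift l (ZMod.isPrimitive_stdAddChar N), ZMod.card]
  split_ifs <;> simp

lemma stdAddChar_add_stdAddChar_neg {N : ℕ} [NeZero N] (x : ZMod N) :
    ZMod.stdAddChar x + ZMod.stdAddChar (-x) = (2 * (ZMod.stdAddChar x).re : ℂ) := by
  rw [AddChar.map_neg_eq_conj, Complex.add_conj, Complex.ofReal_mul, Complex.ofReal_ofNat]

lemma stdAddChar_mul_half (l : ZMod (2 * n)) :
    ZMod.stdAddChar (l * (n : ZMod (2 * n))) = (-1) ^ l.val := by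
  have hhalf : ZMod.stdAddChar (n : ZMod (2 * n)) = -1 := by
    rw [← nsmul_one, AddChar.map_nsmul_eq_pow]
    exact (isPrimitiveRoot_stdAddChar_one.pow (NeZero.pos _) (mul_comm 2 n)).eq_neg_one_of_two_right
  rw [← hhalf, ← AddChar.map_nsmul_eq_pow, nsmul_eq_mul, ZMod.natCast_zmod_val]

lemma sum_stdAddChar_add_add_stdAddChar_sub {N : ℕ} [NeZero N] (K : Finset ℕ) (j l : ZMod N) :
    ∑ k ∈ K, (ZMod.stdAddChar ((j + (k : ZMod N)) * l) +
        ZMod.stdAddChar ((j - (k : ZMod N)) * l)) =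
      (∑ k ∈ K, (2 * (ZMod.stdAddChar ((k : ZMod N) * l)).re : ℂ)) * ZMod.stdAddChar (j * l) := by
  rw [Finset.sum_mul]
  refine Finset.sum_congr rfl fun k _ => ?_
  rw [← stdAddChar_add_stdAddChar_neg, add_mul, sub_mul, sub_eq_add_neg, AddChar.map_add_eq_mul,
    AddChar.map_add_eq_mul]
  ring

/-- The eigenvectors of the Cayley graph, indexed by a character `l` of `⟨a⟩` and a sign `ε` which
relates the values on the two cosets of `⟨a⟩`. They are normalized to sum to the indicator of `1`,
and for `l = 0` the eigenvalue depends on `ε`. -/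
noncomputable def eigenvector (i : ZMod (2 * n) × ℤˣ) : QuaternionGroup n → ℂ
  | a j => (4 * n : ℂ)⁻¹ * ZMod.stdAddChar (j * i.1)
  | xa j => ((i.2 : ℤ) : ℂ) * ((4 * n : ℂ)⁻¹ * ZMod.stdAddChar (j * i.1))

/-- The eigenvalue of `eigenvector i`. -/
noncomputable def eigenvalue (K : Finset ℕ) (i : ZMod (2 * n) × ℤˣ) : ℝ :=
  ∑ k ∈ K, 2 * (ZMod.stdAddChar ((k : ZMod (2 * n)) * i.1)).re +
    if i.1 = 0 then 2 * n * ((i.2 : ℤ) : ℝ) else 0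

lemma adjMatrix_mulVec_eigenvector {K : Finset ℕ} (hK : ∀ k ∈ K, 1 ≤ k ∧ k ≤ n - 1)
    (i : ZMod (2 * n) × ℤˣ) :
    (cayleyGraph (connectionSet n K)).adjMatrix ℂ *ᵥ eigenvector i =
      (eigenvalue K i : ℂ) • eigenvector i := by
  obtain ⟨l, ε⟩ := i
  have hε : ((ε : ℤ) : ℂ) * ((ε : ℤ) : ℂ) = 1 := by
    rw [← Int.cast_mul, ← Units.val_mul, Int.units_mul_self, Units.val_one, Int.cast_one]
  have hcoset (e : ZMod (2 * n) ≃ ZMod (2 * n)) (j : ZMod (2 * n)) :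
      ∑ i, ZMod.stdAddChar (e i * l) =
        (if l = 0 then 2 * n else 0 : ℂ) * ZMod.stdAddChar (j * l) := by
    rw [e.sum_comp fun i => ZMod.stdAddChar (i * l), sum_stdAddChar_mul]
    split_ifs with hl <;> simp [hl]
  funext g
  rw [adjMatrix_connectionSet_mulVec_apply hK, Pi.smul_apply, smul_eq_mul]
  obtain j | j := g
  · have hsum := hcoset (Equiv.addLeft j) j
    have hcirc := sum_stdAddChar_add_add_stdAddChar_sub K j l
    simp only [Equiv.coe_addLeft] at hsum
    simp only [a_mul_a, xa_mul_a, eigenvector, eigenvalue, add_comm _ j, ← sub_eq_add_neg,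
      ← mul_add, ← Finset.mul_sum, hcirc, hsum]
    split_ifs <;> push_cast <;> ring
  · have hsum := hcoset (Equiv.subLeft (n + j)) j
    have hcirc := sum_stdAddChar_add_add_stdAddChar_sub K j l
    simp only [Equiv.subLeft_apply] at hsum
    simp only [a_mul_xa, xa_mul_xa, eigenvector, eigenvalue, sub_neg_eq_add,
      ← mul_add, ← Finset.mul_sum, add_comm (ZMod.stdAddChar ((j - _) * l)), hcirc, hsum]
    split_ifs
    · push_cast
      linear_combination (-(2 * n) * (4 * n : ℂ)⁻¹ * ZMod.stdAddChar (j * l)) * hε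
    · push_cast
      ring

lemma sum_stdAddChar_mul_smul_eigenvector (d : ZMod (2 * n)) :
    ∑ i : ZMod (2 * n) × ℤˣ, ZMod.stdAddChar (i.1 * d) • eigenvector i = Pi.single (a (-d)) 1 := by
  have hsign (f : ℤˣ → ℂ) : ∑ ε, f ε = f 1 + f (-1) := by
    rw [UnitsInt.univ, Finset.sum_pair (by decide)]
  funext g
  simp only [Finset.sum_apply, Pi.smul_apply, Fintype.sum_prod_type, hsign, smul_eq_mul]
  obtain j | j := g
  · have hl (l : ZMod (2 * n)) : ZMod.stdAddChar (l * d) * eigenvector (l, 1) (a j) +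
        ZMod.stdAddChar (l * d) * eigenvector (l, -1) (a j) =
          (2 * n : ℂ)⁻¹ * ZMod.stdAddChar (l * (d + j)) := by
      rw [mul_add, AddChar.map_add_eq_mul, eigenvector, eigenvector, mul_comm j]
      ring
    have hn : (n : ℂ) ≠ 0 := NeZero.ne _
    simp only [hl, ← Finset.mul_sum, sum_stdAddChar_mul, Pi.single_apply, a.injEq,
      eq_neg_iff_add_eq_zero, add_comm j]
    split_ifs
    · push_cast
      field_simp
    · rw [mul_zero]
  · simp [eigenvector]

lemma aeval_stdAddChar_one_eigenvaluePoly (K : Finset ℕ) (i : ZMod (2 * n) × ℤˣ) :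
    aeval (ZMod.stdAddChar (1 : ZMod (2 * n))) (eigenvaluePoly K i) = (eigenvalue K i : ℂ) := by
  obtain ⟨l, ε⟩ := i
  have hmonomial (k : ℕ) : ZMod.stdAddChar (1 : ZMod (2 * n)) ^ (l.val * k) =
      ZMod.stdAddChar ((k : ZMod (2 * n)) * l) := by
    rw [← AddChar.map_nsmul_eq_pow, nsmul_one, Nat.cast_mul, ZMod.natCast_zmod_val, mul_comm l]
  have hpred : ((2 * n - 1 : ℕ) : ZMod (2 * n)) = -1 := by
    rw [Nat.cast_sub (NeZero.pos (2 * n)), ZMod.natCast_self, Nat.cast_one, zero_sub]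
  have hneg (k : ℕ) : ZMod.stdAddChar (1 : ZMod (2 * n)) ^ ((2 * n - 1) * (l.val * k)) =
      ZMod.stdAddChar (-((k : ZMod (2 * n)) * l)) := by
    rw [mul_comm (2 * n - 1), pow_mul, hmonomial, ← AddChar.map_nsmul_eq_pow, nsmul_eq_mul, hpred,
      neg_one_mul]
  simp only [eigenvaluePoly, eigenvalue, map_add, map_sum, map_pow, aeval_X, hmonomial, hneg,
    stdAddChar_add_stdAddChar_neg, apply_ite (aeval _), aeval_C, map_zero]
  split_ifs <;> simp

lemma aeval_neg_one_eigenvaluePoly {p : ℕ} (hpn : p ∣ n) (K : Finset ℕ) (i : ZMod (2 * n) × ℤˣ) :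
    aeval (-1 : ZMod p) (eigenvaluePoly K i) = 2 * ∑ k ∈ K, ((-1) ^ i.1.val) ^ k := by
  have hodd : Odd (2 * n - 1) := Nat.Even.sub_odd (NeZero.pos (2 * n)) (even_two_mul n) odd_one
  have hn : (n : ZMod p) = 0 := (ZMod.natCast_eq_zero_iff _ _).mpr hpn
  have hconst : aeval (-1 : ZMod p) (if i.1 = 0 then C (2 * n * (i.2 : ℤ)) else 0) = 0 := by
    split_ifs <;> simp [hn]
  rw [eigenvaluePoly, map_add, hconst, add_zero, map_sum, Finset.mul_sum]
  refine Finset.sum_congr rfl fun k _ => ?_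
  rw [map_add, map_pow, map_pow, aeval_X, pow_mul _ (2 * n - 1), hodd.neg_one_pow, ← two_mul,
    pow_mul]

theorem sum_zsmul_phase_eq_zero {p m : ℕ} [Fact p.Prime] (hodd : Odd p) (hm : 1 ≤ m)
    (hn : n = p ^ m) (K : Finset ℕ) (c : ZMod (2 * n) × ℤˣ → ℤ)
    (hc : ∑ i, (c i : ℝ) * eigenvalue K i = 0) : ∑ i, c i • phase p K ((-1) ^ i.1.val) = 0 := by
  have hp2 : p ≠ 2 := by rintro rfl; exact absurd hodd (by decide)
  have : NeZero ((2 : ℕ) : ZMod p) :=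
    NeZero.of_not_dvd _ ((Nat.prime_dvd_prime_iff_eq Fact.out Nat.prime_two).not.mpr hp2)
  have hζ : IsPrimitiveRoot (ZMod.stdAddChar (1 : ZMod (2 * n))) (p ^ m * 2) := by
    simpa only [hn, mul_comm 2] using isPrimitiveRoot_stdAddChar_one (N := 2 * n)
  have hvanish :
      aeval (ZMod.stdAddChar (1 : ZMod (2 * n))) (∑ i, c i • eigenvaluePoly K i) = 0 := by
    simp only [map_sum, map_zsmul, aeval_stdAddChar_one_eigenvaluePoly]
    simp only [zsmul_eq_mul]
    exact_mod_cast congrArg Complex.ofReal hc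
  have hmod := aeval_eq_zero_of_isPrimitiveRoot_prime_pow_mul
    (IsPrimitiveRoot.neg_one (R := ZMod p) p hp2) hζ hvanish
  have hpn : p ∣ n := hn ▸ dvd_pow_self p (by omega)
  simp only [map_sum, map_zsmul, aeval_neg_one_eigenvaluePoly hpn] at hmod
  have hcircle := congrArg ZMod.toAddCircle hmod
  simp only [map_sum, map_zsmul, map_zero] at hcircle
  simpa only [phase, Units.val_pow_eq_pow_val, Units.val_neg, Units.val_one, Int.cast_pow,
    Int.cast_neg, Int.cast_one] using hcircle

theorem admitsPGFR_one_genA_pow {p m : ℕ} (hp : p.Prime) (hodd : Odd p) (hm : 1 ≤ m)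
    (hn : n = p ^ m) {K : Finset ℕ} (hK : ∀ k ∈ K, 1 ≤ k ∧ k ≤ n - 1)
    (hcop : (K.filter fun k => Odd k).card.Coprime p) :
    AdmitsPGFR (cayleyGraph (connectionSet n K)) 1 (genA n ^ n) := by
  have : Fact p.Prime := ⟨hp⟩
  have hneg : -(n : ZMod (2 * n)) = n := by
    rw [neg_eq_iff_add_eq_zero, ← two_mul]
    exact_mod_cast ZMod.natCast_self (2 * n)
  rw [genA_pow, one_def]
  refine admitsPGFR_of_eigenvectors ?_ (adjMatrix_mulVec_eigenvector hK)
    (σ := fun i => (-1) ^ i.1.val) ?_ ?_ (phase_one_ne_phase_neg_one hodd hcop) ?_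
  · exact fun h => natCast_half_ne_zero (a.inj h).symm
  · simpa using sum_stdAddChar_mul_smul_eigenvector (n := n) 0
  · simpa [stdAddChar_mul_half, hneg] using sum_stdAddChar_mul_smul_eigenvector (n : ZMod (2 * n))
  · intro c hc
    exact sum_zsmul_phase_eq_zero hodd hm hn K c hc

end Spectrum

end PGFR

theorem mainTheorem2 (p m n : ℕ) [NeZero n] (hp : p.Prime) (hodd : Odd p) (hm : 1 ≤ m)
    (hn : n = p ^ m) (K : Finset ℕ) (hK : ∀ k ∈ K, 1 ≤ k ∧ k ≤ n - 1)
    (hgcd : Nat.gcd (K.filter fun k => Odd k).card p = 1) :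
    ∀ u : ℤ,
      PGFR.AdmitsPGFR (PGFR.cayleyGraph (PGFR.connectionSet n K))
        (PGFR.genA n ^ u) (PGFR.genA n ^ (u + n)) ∧
      PGFR.AdmitsPGFR (PGFR.cayleyGraph (PGFR.connectionSet n K))
        (PGFR.genA n ^ u * PGFR.genB n) (PGFR.genA n ^ (u + n) * PGFR.genB n) := by
  intro u
  have hone := PGFR.admitsPGFR_one_genA_pow hp hodd hm hn hK hgcd
  have hpow : PGFR.genA n ^ (u + n) = PGFR.genA n ^ n * PGFR.genA n ^ u := by
    rw [← zpow_natCast, ← zpow_add, add_comm]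
  have hA := hone.mul_right (PGFR.genA n ^ u)
  rw [one_mul, ← hpow] at hA
  exact ⟨hA, hA.mul_right (PGFR.genB n)⟩
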